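/- Let $k$ be a field, let $n\ge 2$ and $r\ge 3n+2$ be integers, and put $s=r(3n+2)+3$. Let $\mathfrak{P}_{nr}\subset k[x_1,x_2,x_3,x_4]$ be the defining ideal of the monomial curve associated to the Backelin semigroup $\langle s,\,s+3,\,s+3n+1,\,s+3n+2\rangle$, i.e. the kernel of the $k$-algebra homomorphism $k[x_1,x_2,x_3,x_4]\to k[t]$ with $x_1\mapsto t^{s}$, $x_2\mapsto t^{s+3}$, $x_3\mapsto t^{s+3n+1}$, $x_4\mapsto t^{s+3n+2}$. Then $\mathfrak{P}_{nr}$ is minimally generated by the following $3n+4$ binomials: $$f_1=x_2x_3^3-x_1x_4^3,$$ $$f_{2i}=x_1^{n-i}x_3^{3i-1}-x_2^{n-i+1}x_4^{3i-2}\qquad(1\le i\le n),$$ $$f_{3j}=x_1^{r-n+3+j}x_2^{n-1-j}-x_3^{2+3j}x_4^{r-1-3j}\qquad(0\le j\le n-1),$$ $$f_{4j}=x_1^{r-2n+3+j}x_2^{2n-j}-x_3^{3j+1}x_4^{r+1-3j}\qquad(0\le j\le n-1),$$ $$f_5=x_1^{r-n+2}x_2^{n}x_3-x_4^{r+2},\qquad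 f_6=x_2^{n+1}x_3-x_1^{n}x_4^{2},\qquad f_7=x_2^{2n+1}-x_1^{2n-1}x_3x_4.$$ That is, these $3n+4$ binomials are pairwise distinct and generate $\mathfrak{P}_{nr}$, no proper subset of them generates $\mathfrak{P}_{nr}$, and every generating set of $\mathfrak{P}_{nr}$ has at least $3n+4$ elements. -/

import Mathlib

noncomputable section

/-- The defining ideal `𝔭(n₁, …, n_r)` of the affine monomial curve `t ↦ (t^{n₁}, …, t^{n_r})`:
the kernel of the `k`-algebra homomorphism `k[x₁, …, x_r] → k[t]`, `x_i ↦ t^{n_i}`. -/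
def monomialCurveIdeal (k : Type*) [Field k] {r : ℕ} (a : Fin r → ℕ) :
    Ideal (MvPolynomial (Fin r) k) :=
  RingHom.ker
    (MvPolynomial.aeval (fun i => (Polynomial.X : Polynomial k) ^ a i) :
      MvPolynomial (Fin r) k →ₐ[k] Polynomial k)

/-- The generators `s, s + 3, s + 3n + 1, s + 3n + 2` of the Backelin semigroup,
where `s = r(3n + 2) + 3`. -/
def backelinSeq (n r : ℕ) : Fin 4 → ℕ :=
  let s := r * (3 * n + 2) + 3
  ![s, s + 3, s + 3 * n + 1, s + 3 * n + 2]

namespace Backelin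

variable (k : Type*) [Field k]

/-! The variables of `k[x₁, x₂, x₃, x₄]`. -/

abbrev x₁ : MvPolynomial (Fin 4) k := MvPolynomial.X 0
abbrev x₂ : MvPolynomial (Fin 4) k := MvPolynomial.X 1
abbrev x₃ : MvPolynomial (Fin 4) k := MvPolynomial.X 2
abbrev x₄ : MvPolynomial (Fin 4) k := MvPolynomial.X 3

/-! The binomials. For `2 ≤ n`, `3n + 2 ≤ r`, `1 ≤ i ≤ n` in `f₂` and `0 ≤ j ≤ n - 1` in `f₃`, `f₄`,
none of the subtractions in the exponents is truncated. -/

def f₁ : MvPolynomial (Fin 4) k :=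
  x₂ k * x₃ k ^ 3 - x₁ k * x₄ k ^ 3

def f₂ (n i : ℕ) : MvPolynomial (Fin 4) k :=
  x₁ k ^ (n - i) * x₃ k ^ (3 * i - 1) - x₂ k ^ (n - i + 1) * x₄ k ^ (3 * i - 2)

def f₃ (n r j : ℕ) : MvPolynomial (Fin 4) k :=
  x₁ k ^ (r - n + 3 + j) * x₂ k ^ (n - 1 - j) - x₃ k ^ (2 + 3 * j) * x₄ k ^ (r - 1 - 3 * j)

def f₄ (n r j : ℕ) : MvPolynomial (Fin 4) k :=
  x₁ k ^ (r - 2 * n + 3 + j) * x₂ k ^ (2 * n - j) - x₃ k ^ (3 * j + 1) * x₄ k ^ (r + 1 - 3 * j)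

def f₅ (n r : ℕ) : MvPolynomial (Fin 4) k :=
  x₁ k ^ (r - n + 2) * x₂ k ^ n * x₃ k - x₄ k ^ (r + 2)

def f₆ (n : ℕ) : MvPolynomial (Fin 4) k :=
  x₂ k ^ (n + 1) * x₃ k - x₁ k ^ n * x₄ k ^ 2

def f₇ (n : ℕ) : MvPolynomial (Fin 4) k :=
  x₂ k ^ (2 * n + 1) - x₁ k ^ (2 * n - 1) * x₃ k * x₄ k

/-- The set of all the binomials `f₁`, `f₂ᵢ` (`1 ≤ i ≤ n`), `f₃ⱼ`, `f₄ⱼ` (`0 ≤ j ≤ n - 1`),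
`f₅`, `f₆`, `f₇`. -/
def gens (n r : ℕ) : Set (MvPolynomial (Fin 4) k) :=
  {f₁ k} ∪ {p | ∃ i, 1 ≤ i ∧ i ≤ n ∧ p = f₂ k n i} ∪
    {p | ∃ j, j < n ∧ p = f₃ k n r j} ∪ {p | ∃ j, j < n ∧ p = f₄ k n r j} ∪
    {f₅ k n r, f₆ k n, f₇ k n}

end Backelin

end

namespace Backelin

/-- The weight of `x₁ᵃ x₂ᵇ x₃ᶜ x₄ᵈ` in the grading for which the monomial curve is homogeneous. -/
def weight (n r a b c d : ℕ) : ℕ :=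
  a * (r * (3 * n + 2) + 3) + b * (r * (3 * n + 2) + 3 + 3) +
    c * (r * (3 * n + 2) + 3 + 3 * n + 1) + d * (r * (3 * n + 2) + 3 + 3 * n + 2)

/-- The exponents of the monomials in `x₂, x₃, x₄` whose weights form the Apéry set of the
Backelin semigroup with respect to its multiplicity. -/
def IsNormal (n r b c d : ℕ) : Prop :=
  (b = 0 ∧ c + 2 ≤ 3 * n ∧ c + d ≤ r + 1 ∧ (c % 3 = 2 → c + d ≤ r)) ∨
  (b = 1 ∧ c ≤ 2 ∧ d + 1 ≤ r ∧ (c = 2 → d + 2 ≤ r)) ∨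
  (2 ≤ b ∧ b ≤ n ∧ c ≤ 2 ∧ d + 3 * b ≤ 3 * n) ∨
  (n + 1 ≤ b ∧ b ≤ 2 * n ∧ c = 0 ∧ d = 0)

/-- The range of the coordinates `(L, C)` of normal monomials, where
`(3n + 2) L - C = 3 b + (3n + 1) c + (3n + 2) d`. -/
def IsNormalCoord (n r L C : ℤ) : Prop :=
  -3 ≤ C ∧ C + 2 ≤ 3 * n ∧ 0 ≤ L ∧ L ≤ r + 1 ∧ (C = -3 → L ≤ r - 1) ∧
  (C = -2 → 1 ≤ L ∧ L ≤ r) ∧ (C = -1 → 1 ≤ L ∧ L ≤ r) ∧ (1 ≤ C → 1 ≤ L) ∧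
  (3 ≤ C → C % 3 = 0 → 2 ≤ L) ∧ (4 ≤ C → C % 3 = 1 → 2 ≤ L) ∧ (C % 3 = 2 → L ≤ r)

theorem IsNormal.exists_coord {n r b c d : ℕ} (hn : 2 ≤ n) (hr : 3 * n + 2 ≤ r)
    (h : IsNormal n r b c d) :
    ∃ L C : ℤ, (3 * n + 2 : ℤ) * L - C = 3 * b + (3 * n + 1) * c + (3 * n + 2) * d ∧
      IsNormalCoord n r L C ∧
      ((b = 0 ∧ L = c + d ∧ C = c) ∨ (b = 1 ∧ L = c + d ∧ C = c - 3 ∧ c ≤ 2) ∨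
        (2 ≤ b ∧ b ≤ n ∧ L = c + d + 1 ∧ C = 3 * n + 2 - 3 * b + c ∧ c ≤ 2 ∧
          d + 3 * b ≤ 3 * n) ∨
        (b = n + 1 ∧ c = 0 ∧ d = 0 ∧ L = 1 ∧ C = -1) ∨
        (n + 2 ≤ b ∧ b ≤ 2 * n ∧ c = 0 ∧ d = 0 ∧ L = 2 ∧ C = 6 * n + 4 - 3 * b)) := by
  unfold IsNormalCoord
  rcases h with h | h | h | h
  · refine ⟨c + d, c, ?_, ?_, Or.inl ⟨h.1, rfl, rfl⟩⟩
    · rw [h.1]; push_cast; ring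
    · omega
  · refine ⟨c + d, c - 3, ?_, ?_, Or.inr (Or.inl ⟨h.1, rfl, rfl, h.2.1⟩)⟩
    · rw [h.1]; push_cast; ring
    · omega
  · refine ⟨c + d + 1, 3 * n + 2 - 3 * b + c, by ring, ?_, ?_⟩ <;> omega
  · obtain ⟨h1, h2, rfl, rfl⟩ := h
    rcases h1.eq_or_lt with rfl | h1
    · refine ⟨1, -1, ?_, ?_, ?_⟩
      · push_cast; ring
      · omega
      · simp
    · refine ⟨2, 6 * n + 4 - 3 * b, ?_, ?_, ?_⟩
      · push_cast; ring
      · omega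
      · omega

theorem IsNormalCoord.cases {n r L C : ℤ} (h : IsNormalCoord n r L C) :
    (C = -3 ∧ 0 ≤ L ∧ L ≤ r - 1) ∨ (-2 ≤ C ∧ C ≤ -1 ∧ 1 ≤ L ∧ L ≤ r) ∨
    (C = 0 ∧ 0 ≤ L ∧ L ≤ r + 1) ∨ (C = 1 ∧ 1 ≤ L ∧ L ≤ r + 1) ∨
    (2 ≤ C ∧ C % 3 = 2 ∧ 1 ≤ L ∧ L ≤ r) ∨ (3 ≤ C ∧ C % 3 ≠ 2 ∧ 2 ≤ L ∧ L ≤ r + 1) := by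
  unfold IsNormalCoord at h
  omega

theorem IsNormalCoord.eq_of_nonneg {n r L C L' C' t : ℤ} (hn : 2 ≤ n) (hr : 3 * n + 2 ≤ r)
    (h : IsNormalCoord n r L C) (h' : IsNormalCoord n r L' C') (ht : 0 ≤ t)
    (e : (r * (3 * n + 2) + 3) * t + ((3 * n + 2) * L - C) = (3 * n + 2) * L' - C') :
    t = 0 ∧ L = L' ∧ C = C' := by
  have hC : -3 ≤ C ∧ C + 2 ≤ 3 * n ∧ 0 ≤ L ∧ L ≤ r + 1 := ⟨h.1, h.2.1, h.2.2.1, h.2.2.2.1⟩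
  have hC' : -3 ≤ C' ∧ C' + 2 ≤ 3 * n ∧ 0 ≤ L' ∧ L' ≤ r + 1 :=
    ⟨h'.1, h'.2.1, h'.2.2.1, h'.2.2.2.1⟩
  replace h := h.cases
  replace h' := h'.cases
  obtain ⟨m, hm⟩ : ∃ m, m = L - L' + r * t := ⟨_, rfl⟩
  have e1 : (3 * n + 2) * m = C - C' - 3 * t := by rw [hm]; linarith
  have ht1 : t ≤ 1 := by
    by_contra hc
    clear h h' e
    have h2 : r * 2 ≤ r * t := mul_le_mul_of_nonneg_left (by omega) (by omega)
    have h3 : (3 * n + 2) * 1 ≤ (3 * n + 2) * m :=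
      mul_le_mul_of_nonneg_left (by omega) (by omega)
    omega
  have m1 : m < 2 := by
    by_contra hc
    clear h h' e
    have h3 : (3 * n + 2) * 2 ≤ (3 * n + 2) * m :=
      mul_le_mul_of_nonneg_left (by omega) (by omega)
    omega
  have m2 : -2 < m := by
    by_contra hc
    clear h h' e
    have h3 : (3 * n + 2) * m ≤ (3 * n + 2) * (-2) :=
      mul_le_mul_of_nonneg_left (by omega) (by omega)
    omega
  obtain rfl | rfl : t = 0 ∨ t = 1 := by omega
  · obtain rfl | rfl | rfl : m = -1 ∨ m = 0 ∨ m = 1 := by omega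
    all_goals clear h h' e; omega
  · exfalso
    clear e
    obtain rfl | rfl | rfl : m = -1 ∨ m = 0 ∨ m = 1 := by omega
    all_goals
      rcases h with h | h | h | h | h | h <;> rcases h' with h' | h' | h' | h' | h' | h' <;> omega

theorem IsNormalCoord.eq {n r L C L' C' t : ℤ} (hn : 2 ≤ n) (hr : 3 * n + 2 ≤ r)
    (h : IsNormalCoord n r L C) (h' : IsNormalCoord n r L' C')
    (e : (r * (3 * n + 2) + 3) * t + ((3 * n + 2) * L - C) = (3 * n + 2) * L' - C') :
    t = 0 ∧ L = L' ∧ C = C' := by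
  rcases le_total 0 t with ht | ht
  · exact h.eq_of_nonneg hn hr h' ht e
  · obtain ⟨h1, h2, h3⟩ := h'.eq_of_nonneg hn hr h (t := -t) (by omega) (by linarith)
    exact ⟨by omega, h2.symm, h3.symm⟩

theorem IsNormal.eq_of_weight_eq {n r a b c d a' b' c' d' : ℕ} (hn : 2 ≤ n)
    (hr : 3 * n + 2 ≤ r) (h : IsNormal n r b c d) (h' : IsNormal n r b' c' d')
    (e : weight n r a b c d = weight n r a' b' c' d') :
    a = a' ∧ b = b' ∧ c = c' ∧ d = d' := by
  obtain ⟨L, C, e1, hc, hd⟩ := h.exists_coord hn hr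
  obtain ⟨L', C', e1', hc', hd'⟩ := h'.exists_coord hn hr
  unfold weight at e
  zify at e
  obtain ⟨h1, rfl, rfl⟩ := hc.eq (t := (a + b + c + d : ℤ) - (a' + b' + c' + d'))
    (by exact_mod_cast hn) (by exact_mod_cast hr) hc' (by rw [e1, e1']; linear_combination e)
  clear e e1 e1' hc hc' h h'
  rcases hd with hd | hd | hd | hd | hd <;> rcases hd' with hd' | hd' | hd' | hd' | hd' <;> omega

/-- The weight of a monomial determines it among the monomials sharing a variable with it. -/
def IsIsolated (n r a b c d : ℕ) : Prop :=
  ∀ a' b' c' d', weight n r a' b' c' d' = weight n r a b c d →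
    (0 < a ∧ 0 < a' ∨ 0 < b ∧ 0 < b' ∨ 0 < c ∧ 0 < c' ∨ 0 < d ∧ 0 < d') →
    a' = a ∧ b' = b ∧ c' = c ∧ d' = d

end Backelin

namespace Backelin

theorem weight_eq_cases {n r a b c d a' b' c' d' : ℕ}
    (h : weight n r a' b' c' d' = weight n r a b c d)
    (hW : (3 * b + (3 * n + 1) * c + (3 * n + 2) * d : ℤ) < r * (3 * n + 2) + 3)
    (hD : a + b + c + d ≤ r + 3) (hr' : 4 ≤ r) :
    (a' + b' + c' + d' = a + b + c + d ∧
      (3 * n + 2 : ℤ) * (c' + d') = c' - 3 * b' + (3 * b - c + (3 * n + 2) * (c + d))) ∨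
    (a' + b' + c' + d' + 1 = a + b + c + d ∧
      (3 * n + 2 : ℤ) * (c' + d' - r) =
        c' - 3 * b' + 3 + (3 * b - c + (3 * n + 2) * (c + d))) := by
  unfold weight at h
  zify at h
  obtain ⟨t, ht⟩ : ∃ t : ℤ, t = (a + b + c + d : ℤ) - (a' + b' + c' + d') := ⟨_, rfl⟩
  have e : (3 * b' + (3 * n + 1) * c' + (3 * n + 2) * d' : ℤ) =
      (r * (3 * n + 2) + 3) * t + (3 * b + (3 * n + 1) * c + (3 * n + 2) * d) := by
    rw [ht]; linear_combination h
  have h0 : (0 : ℤ) ≤ 3 * b' + (3 * n + 1) * c' + (3 * n + 2) * d' := by positivity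
  have h0' : (0 : ℤ) ≤ 3 * b + (3 * n + 1) * c + (3 * n + 2) * d := by positivity
  have hs : (0 : ℤ) ≤ r * (3 * n + 2) + 3 := by positivity
  have t0 : 0 ≤ t := by
    by_contra hc
    have := mul_le_mul_of_nonneg_left (show t ≤ -1 by omega) hs
    linarith
  have t1 : t ≤ 1 := by
    by_contra hc
    have h1 := mul_le_mul_of_nonneg_left (show 2 ≤ t by omega) hs
    have h2 : (3 * b' + (3 * n + 1) * c' + (3 * n + 2) * d' : ℤ) ≤
        (3 * n + 2) * (b' + c' + d') + b' := by
      have : (0 : ℤ) ≤ 3 * n * b' := by positivity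
      nlinarith
    have h3 : (3 * n + 2 : ℤ) * (b' + c' + d') ≤ (3 * n + 2) * (r + 1) :=
      mul_le_mul_of_nonneg_left (by omega) (by omega)
    have h4 : (3 * n + 2 : ℤ) * 4 ≤ (3 * n + 2) * r :=
      mul_le_mul_of_nonneg_left (by omega) (by omega)
    have h5 : (b' : ℤ) ≤ r + 1 := by omega
    nlinarith
  obtain rfl | rfl : t = 0 ∨ t = 1 := by omega
  · exact Or.inl ⟨by omega, by linear_combination e⟩
  · exact Or.inr ⟨by omega, by linear_combination e⟩

variable {n r : ℕ}

theorem isIsolated_f₁ (hn : 2 ≤ n) (hr : 3 * n + 2 ≤ r) : IsIsolated n r 0 1 3 0 := by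
  intro a' b' c' d' h hs
  have hb : (8 : ℤ) * (3 * n + 2) ≤ r * (3 * n + 2) :=
    mul_le_mul_of_nonneg_right (by omega) (by omega)
  rcases weight_eq_cases h (by push_cast; linarith) (by omega) (by omega) with
    ⟨h1, h2⟩ | ⟨h1, h2⟩
  · obtain ⟨M, hM⟩ : ∃ M : ℤ, M = c' + d' := ⟨_, rfl⟩
    rw [← hM] at h2
    obtain rfl | rfl | rfl | rfl | rfl : M = 0 ∨ M = 1 ∨ M = 2 ∨ M = 3 ∨ M = 4 := by omega
    all_goals omega
  · have := mul_le_mul_of_nonneg_left (show (c' + d' - r : ℤ) ≤ 0 by omega)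
      (show (0 : ℤ) ≤ 3 * n + 2 by omega)
    omega

theorem isIsolated_f₂ (hn : 2 ≤ n) (hr : 3 * n + 2 ≤ r) {i : ℕ} (hi : 1 ≤ i) (hi' : i ≤ n) :
    IsIsolated n r (n - i) 0 (3 * i - 1) 0 := by
  intro a' b' c' d' h hs
  obtain ⟨q, hq⟩ : ∃ q, q = 3 * i - 1 := ⟨_, rfl⟩
  rw [← hq] at h hs ⊢
  have hb : (q : ℤ) * (3 * n + 2) ≤ r * (3 * n + 2) :=
    mul_le_mul_of_nonneg_right (by omega) (by omega)
  rcases weight_eq_cases h (by push_cast; linarith) (by omega) (by omega) with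
    ⟨h1, h2⟩ | ⟨h1, h2⟩
  · obtain ⟨M, hM⟩ : ∃ M : ℤ, M = c' + d' - q := ⟨_, rfl⟩
    have h3 : (3 * n + 2 : ℤ) * M = c' - 3 * b' - q := by rw [hM]; push_cast at h2; linarith
    have M1 : M < 1 := by
      by_contra hc
      have : (0 : ℤ) < (3 * n + 1) * M := mul_pos (by omega) (by omega)
      have : (3 * n + 1 : ℤ) * M = c' - 3 * b' - q - M := by linarith
      omega
    have M2 : -2 < M := by
      by_contra hc
      have h4 := mul_le_mul_of_nonneg_left (show M ≤ -2 by omega)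
        (show (0 : ℤ) ≤ 3 * n - 1 by omega)
      have h5 : (3 * n - 1 : ℤ) * M = c' - 3 * b' - q - 3 * M := by linarith
      omega
    obtain rfl | rfl : M = -1 ∨ M = 0 := by omega
    all_goals omega
  · have h3 : (3 * n + 2 : ℤ) * (c' + d' - r - q) = c' - 3 * b' + 3 - q := by
      push_cast at h2; linarith
    have := mul_le_mul_of_nonneg_left (show (c' + d' - r - q : ℤ) ≤ -q by omega)
      (show (0 : ℤ) ≤ 3 * n + 2 by omega)
    have := mul_le_mul_of_nonneg_left (show (-q : ℤ) ≤ -2 by omega)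
      (show (0 : ℤ) ≤ 3 * n + 2 by omega)
    have := mul_le_mul_of_nonneg_left (show (c' + d' - r - q : ℤ) ≤ -3 - b' by omega)
      (show (0 : ℤ) ≤ 3 * n + 2 by omega)
    have : (0 : ℤ) ≤ n * b' := by positivity
    nlinarith

theorem isIsolated_f₃ (hn : 2 ≤ n) (hr : 3 * n + 2 ≤ r) {j : ℕ} (hj : j < n) :
    IsIsolated n r (r - n + 3 + j) (n - 1 - j) 0 0 := by
  intro a' b' c' d' h hs
  have hb : (8 : ℤ) * (3 * n + 2) ≤ r * (3 * n + 2) :=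
    mul_le_mul_of_nonneg_right (by omega) (by omega)
  rcases weight_eq_cases h (by omega) (by omega) (by omega) with ⟨h1, h2⟩ | ⟨h1, h2⟩
  · have : (c' + d' : ℤ) < 1 := by
      by_contra hc
      have : (3 * n + 2 : ℤ) * (c' + d') = (3 * n + 1 : ℤ) * (c' + d') + (c' + d') := by ring
      have := mul_le_mul_of_nonneg_left (show (1 : ℤ) ≤ c' + d' by omega)
        (show (0 : ℤ) ≤ 3 * n + 1 by omega)
      omega
    have h3 : (c' + d' : ℤ) = 0 := by omega
    rw [h3] at h2
    omega
  · exfalso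
    obtain ⟨M, hM⟩ : ∃ M : ℤ, M = c' + d' - r := ⟨_, rfl⟩
    rw [← hM] at h2
    have M2 : -1 < M := by
      by_contra hc
      have h4 := mul_le_mul_of_nonneg_left (show M ≤ -1 by omega)
        (show (0 : ℤ) ≤ 3 * n - 1 by omega)
      have h5 : (3 * n - 1 : ℤ) * M = (3 * n + 2) * M - 3 * M := by ring
      omega
    obtain rfl | rfl : M = 0 ∨ M = 1 := by omega
    all_goals omega

theorem isIsolated_f₄ (hn : 2 ≤ n) (hr : 3 * n + 2 ≤ r) {j : ℕ} (hj : j < n) :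
    IsIsolated n r (r - 2 * n + 3 + j) (2 * n - j) 0 0 := by
  intro a' b' c' d' h hs
  have hb : (8 : ℤ) * (3 * n + 2) ≤ r * (3 * n + 2) :=
    mul_le_mul_of_nonneg_right (by omega) (by omega)
  rcases weight_eq_cases h (by omega) (by omega) (by omega) with ⟨h1, h2⟩ | ⟨h1, h2⟩
  · have : (c' + d' : ℤ) < 2 := by
      by_contra hc
      have : (3 * n + 2 : ℤ) * (c' + d') = (3 * n + 1 : ℤ) * (c' + d') + (c' + d') := by ring
      have := mul_le_mul_of_nonneg_left (show (2 : ℤ) ≤ c' + d' by omega)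
        (show (0 : ℤ) ≤ 3 * n + 1 by omega)
      omega
    obtain h3 | h3 : (c' + d' : ℤ) = 0 ∨ (c' + d' : ℤ) = 1 := by omega
    all_goals rw [h3] at h2; omega
  · exfalso
    obtain ⟨M, hM⟩ : ∃ M : ℤ, M = c' + d' - r := ⟨_, rfl⟩
    rw [← hM] at h2
    have M2 : -1 < M := by
      by_contra hc
      have h4 := mul_le_mul_of_nonneg_left (show M ≤ -1 by omega)
        (show (0 : ℤ) ≤ 3 * n - 1 by omega)
      have h5 : (3 * n - 1 : ℤ) * M = (3 * n + 2) * M - 3 * M := by ring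
      omega
    obtain rfl | rfl | rfl : M = 0 ∨ M = 1 ∨ M = 2 := by omega
    all_goals omega

theorem isIsolated_f₅ (hn : 2 ≤ n) (hr : 3 * n + 2 ≤ r) :
    IsIsolated n r (r - n + 2) n 1 0 := by
  intro a' b' c' d' h hs
  have hb : (8 : ℤ) * (3 * n + 2) ≤ r * (3 * n + 2) :=
    mul_le_mul_of_nonneg_right (by omega) (by omega)
  rcases weight_eq_cases h (by omega) (by omega) (by omega) with ⟨h1, h2⟩ | ⟨h1, h2⟩
  · have : (c' + d' : ℤ) < 3 := by
      by_contra hc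
      have : (3 * n + 2 : ℤ) * (c' + d') = (3 * n + 1 : ℤ) * (c' + d') + (c' + d') := by ring
      have := mul_le_mul_of_nonneg_left (show (3 : ℤ) ≤ c' + d' by omega)
        (show (0 : ℤ) ≤ 3 * n + 1 by omega)
      omega
    obtain h3 | h3 | h3 : (c' + d' : ℤ) = 0 ∨ (c' + d' : ℤ) = 1 ∨ (c' + d' : ℤ) = 2 := by omega
    all_goals rw [h3] at h2; omega
  · exfalso
    obtain ⟨M, hM⟩ : ∃ M : ℤ, M = c' + d' - r := ⟨_, rfl⟩
    rw [← hM] at h2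
    have M2 : -1 < M := by
      by_contra hc
      have h4 := mul_le_mul_of_nonneg_left (show M ≤ -1 by omega)
        (show (0 : ℤ) ≤ 3 * n - 1 by omega)
      have h5 : (3 * n - 1 : ℤ) * M = (3 * n + 2) * M - 3 * M := by ring
      omega
    obtain rfl | rfl | rfl : M = 0 ∨ M = 1 ∨ M = 2 := by omega
    all_goals omega

theorem isIsolated_f₆ (hn : 2 ≤ n) (hr : 3 * n + 2 ≤ r) : IsIsolated n r 0 (n + 1) 1 0 := by
  intro a' b' c' d' h hs
  have hb : (8 : ℤ) * (3 * n + 2) ≤ r * (3 * n + 2) :=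
    mul_le_mul_of_nonneg_right (by omega) (by omega)
  rcases weight_eq_cases h (by omega) (by omega) (by omega) with ⟨h1, h2⟩ | ⟨h1, h2⟩
  · have : (c' + d' : ℤ) < 3 := by
      by_contra hc
      have : (3 * n + 2 : ℤ) * (c' + d') = (3 * n + 1 : ℤ) * (c' + d') + (c' + d') := by ring
      have := mul_le_mul_of_nonneg_left (show (3 : ℤ) ≤ c' + d' by omega)
        (show (0 : ℤ) ≤ 3 * n + 1 by omega)
      omega
    obtain h3 | h3 | h3 : (c' + d' : ℤ) = 0 ∨ (c' + d' : ℤ) = 1 ∨ (c' + d' : ℤ) = 2 := by omega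
    all_goals rw [h3] at h2; omega
  · have := mul_le_mul_of_nonneg_left (show (c' + d' - r : ℤ) ≤ 0 by omega)
      (show (0 : ℤ) ≤ 3 * n + 2 by omega)
    omega

theorem isIsolated_f₇ (hn : 2 ≤ n) (hr : 3 * n + 2 ≤ r) : IsIsolated n r 0 (2 * n + 1) 0 0 := by
  intro a' b' c' d' h hs
  have hb : (8 : ℤ) * (3 * n + 2) ≤ r * (3 * n + 2) :=
    mul_le_mul_of_nonneg_right (by omega) (by omega)
  rcases weight_eq_cases h (by omega) (by omega) (by omega) with ⟨h1, h2⟩ | ⟨h1, h2⟩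
  · have : (c' + d' : ℤ) < 3 := by
      by_contra hc
      have : (3 * n + 2 : ℤ) * (c' + d') = (3 * n + 1 : ℤ) * (c' + d') + (c' + d') := by ring
      have := mul_le_mul_of_nonneg_left (show (3 : ℤ) ≤ c' + d' by omega)
        (show (0 : ℤ) ≤ 3 * n + 1 by omega)
      omega
    obtain h3 | h3 | h3 : (c' + d' : ℤ) = 0 ∨ (c' + d' : ℤ) = 1 ∨ (c' + d' : ℤ) = 2 := by omega
    all_goals rw [h3] at h2; omega
  · have := mul_le_mul_of_nonneg_left (show (c' + d' - r : ℤ) ≤ 0 by omega)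
      (show (0 : ℤ) ≤ 3 * n + 2 by omega)
    omega

end Backelin

section MonomialCurve

open MvPolynomial

variable {k : Type*} [Field k] {m : ℕ}

theorem aeval_monomial_pow (a : Fin m → ℕ) (u : Fin m →₀ ℕ) (c : k) :
    aeval (fun i => (Polynomial.X : Polynomial k) ^ a i) (monomial u c) =
      Polynomial.monomial (∑ i, u i * a i) c := by
  rw [aeval_monomial, Finsupp.prod_fintype _ _ (fun i => pow_zero _)]
  simp_rw [← pow_mul]
  rw [Finset.prod_pow_eq_pow_sum, Polynomial.algebraMap_eq, Polynomial.C_mul_X_pow_eq_monomial]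
  simp_rw [mul_comm]

/-- An element of the ideal of a monomial curve has coefficient zero at every monomial that is
alone in its degree. -/
theorem coeff_eq_zero_of_mem_monomialCurveIdeal {a : Fin m → ℕ} {p : MvPolynomial (Fin m) k}
    (hp : p ∈ monomialCurveIdeal k a) {u : Fin m →₀ ℕ}
    (hu : ∀ v : Fin m →₀ ℕ, ∑ i, v i * a i = ∑ i, u i * a i → v = u) : coeff u p = 0 := by
  have h : aeval (fun i => (Polynomial.X : Polynomial k) ^ a i) p = 0 := hp
  rw [p.as_sum, map_sum] at h
  simp_rw [aeval_monomial_pow] at h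
  replace h := congrArg (fun q => Polynomial.coeff q (∑ i, u i * a i)) h
  simp only [Polynomial.finsetSum_coeff, Polynomial.coeff_monomial, Polynomial.coeff_zero] at h
  rw [Finset.sum_eq_single u] at h
  · simpa using h
  · intro v _ hv
    exact if_neg fun e => hv (hu v e)
  · intro hu'
    simpa using hu'

/-- An ideal containing all differences of monomials of the same degree contains the ideal of the
monomial curve. -/
theorem monomialCurveIdeal_le {a : Fin m → ℕ} {I : Ideal (MvPolynomial (Fin m) k)}
    (h : ∀ u v : Fin m →₀ ℕ, ∑ i, u i * a i = ∑ i, v i * a i →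
      (monomial u (1 : k) - monomial v 1) ∈ I) : monomialCurveIdeal k a ≤ I := by
  classical
  let ψ : Polynomial k →ₗ[k] MvPolynomial (Fin m) k ⧸ I :=
    (Polynomial.basisMonomials k).constr k fun w =>
      if hw : ∃ u : Fin m →₀ ℕ, ∑ i, u i * a i = w then
        Ideal.Quotient.mk I (monomial hw.choose 1) else 0
  have key : ψ ∘ₗ (aeval fun i => (Polynomial.X : Polynomial k) ^ a i).toLinearMap =
      (Ideal.Quotient.mkₐ k I).toLinearMap := by
    refine MvPolynomial.linearMap_ext fun u => LinearMap.ext_ring ?_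
    have hw : ∃ v : Fin m →₀ ℕ, ∑ i, v i * a i = ∑ i, u i * a i := ⟨u, rfl⟩
    have e : ψ (Polynomial.monomial (∑ i, u i * a i) 1) =
        Ideal.Quotient.mk I (monomial hw.choose 1) := by
      have := (Polynomial.basisMonomials k).constr_basis k (fun w =>
        if hw : ∃ u : Fin m →₀ ℕ, ∑ i, u i * a i = w then
          Ideal.Quotient.mk I (monomial hw.choose 1) else 0) (∑ i, u i * a i)
      rw [Polynomial.coe_basisMonomials, dif_pos hw] at this
      exact this
    simp only [LinearMap.comp_apply, AlgHom.toLinearMap_apply, aeval_monomial_pow, e,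
      Ideal.Quotient.mkₐ_eq_mk]
    exact Ideal.Quotient.eq.2 (h _ _ hw.choose_spec)
  intro p hp
  have h0 : aeval (fun i => (Polynomial.X : Polynomial k) ^ a i) p = 0 := hp
  have := LinearMap.congr_fun key p
  rw [LinearMap.comp_apply, AlgHom.toLinearMap_apply, h0, map_zero] at this
  exact Ideal.Quotient.eq_zero_iff_mem.1 this.symm

end MonomialCurve

section MinimalGenerators

open MvPolynomial

variable {k σ ι : Type*} [Field k] [Fintype ι]

/-- If the coefficients at the monomials `u i` vanish on `𝔪 I`, where `𝔪` is generated by the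
variables, and form a dual system to elements `g i` of `I`, then every generating set of `I` has at
least as many elements as there are indices `i`. -/
theorem card_le_encard_of_span_eq [DecidableEq ι] {I : Ideal (MvPolynomial σ k)}
    {u : ι → σ →₀ ℕ} {g : ι → MvPolynomial σ k} (hg : ∀ i, g i ∈ I)
    (hug : ∀ i j, coeff (u i) (g j) = if i = j then 1 else 0)
    (hu : ∀ i x, ∀ p ∈ I, coeff (u i) (X x * p) = 0)
    {T : Set (MvPolynomial σ k)} (hT : Ideal.span T = I) :
    (Fintype.card ι : ℕ∞) ≤ T.encard := by
  classical
  let Λ : MvPolynomial σ k →ₗ[k] ι → k := LinearMap.pi fun i => lcoeff k (u i)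
  have hΛ : ∀ p i, Λ p i = coeff (u i) p := fun p i => rfl
  have hmul : ∀ q, ∀ p ∈ I, Λ (q * p) = constantCoeff q • Λ p := by
    intro q
    induction q using MvPolynomial.induction_on with
    | C a =>
      intro p _
      rw [constantCoeff_C, ← smul_eq_C_mul, map_smul]
    | add q₁ q₂ h₁ h₂ =>
      intro p hp
      rw [add_mul, map_add, h₁ p hp, h₂ p hp, map_add, add_smul]
    | mul_X q x _ =>
      intro p hp
      rw [map_mul constantCoeff, constantCoeff_X, mul_zero, zero_smul, mul_comm q, mul_assoc]
      funext i
      exact hu i x _ (I.mul_mem_left q hp)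
  have hspan : ∀ p ∈ I, Λ p ∈ Submodule.span k (Λ '' T) := by
    intro p hp
    rw [← hT] at hp
    induction hp using Submodule.span_induction with
    | mem x hx => exact Submodule.subset_span ⟨x, hx, rfl⟩
    | zero => rw [map_zero]; exact zero_mem _
    | add x y _ _ hx hy => rw [map_add]; exact add_mem hx hy
    | smul q x hx' hx =>
      rw [smul_eq_mul, hmul q x (hT ▸ hx')]
      exact Submodule.smul_mem _ _ hx
  have htop : Submodule.span k (Λ '' T) = ⊤ := by
    rw [eq_top_iff, ← (Pi.basisFun k ι).span_eq, Submodule.span_le]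
    rintro _ ⟨j, rfl⟩
    have : (Pi.basisFun k ι) j = Λ (g j) := by
      funext i
      rw [hΛ, hug, Pi.basisFun_apply, Pi.single_apply]
    rw [this]
    exact hspan _ (hg j)
  by_cases hfin : T.Finite
  · have := (hfin.image Λ).fintype
    have h1 := finrank_span_le_card (R := k) (Λ '' T)
    rw [htop, finrank_top, Module.finrank_fintype_fun_eq_card, ← Set.ncard_eq_toFinset_card'] at h1
    calc (Fintype.card ι : ℕ∞) ≤ ((Λ '' T).ncard : ℕ∞) := by exact_mod_cast h1
      _ = (Λ '' T).encard := (hfin.image Λ).cast_ncard_eq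
      _ ≤ T.encard := Set.encard_image_le _ _
  · rw [Set.Infinite.encard_eq hfin]
    exact le_top

end MinimalGenerators

namespace Backelin

open MvPolynomial

variable {k : Type*} [Field k] {n r : ℕ}

/-- The exponent vector `(a, b, c, d)`. -/
noncomputable def expo (a b c d : ℕ) : Fin 4 →₀ ℕ := Finsupp.equivFunOnFinite.symm ![a, b, c, d]

theorem expo_inj {a b c d a' b' c' d' : ℕ} :
    expo a b c d = expo a' b' c' d' ↔ a = a' ∧ b = b' ∧ c = c' ∧ d = d' := by
  refine ⟨fun h => ?_, by rintro ⟨rfl, rfl, rfl, rfl⟩; rfl⟩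
  have h := fun i => DFunLike.congr_fun h i
  exact ⟨h 0, h 1, h 2, h 3⟩

theorem eq_expo (u : Fin 4 →₀ ℕ) : u = expo (u 0) (u 1) (u 2) (u 3) := by
  ext i
  fin_cases i <;> rfl

theorem sum_expo (a b c d : ℕ) :
    ∑ i, expo a b c d i * backelinSeq n r i = weight n r a b c d := by
  simp [expo, backelinSeq, weight, Fin.sum_univ_four]

theorem monomial_expo (a b c d : ℕ) :
    monomial (expo a b c d) (1 : k) = x₁ k ^ a * x₂ k ^ b * x₃ k ^ c * x₄ k ^ d := by
  rw [monomial_eq, C_1, one_mul, Finsupp.prod_fintype _ _ (fun i => pow_zero _),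
    Fin.prod_univ_four]
  rfl

theorem monomial_sub_mem_iff {a b c d a' b' c' d' : ℕ} :
    monomial (expo a b c d) (1 : k) - monomial (expo a' b' c' d') 1 ∈
      monomialCurveIdeal k (backelinSeq n r) ↔
    weight n r a b c d = weight n r a' b' c' d' := by
  rw [monomialCurveIdeal, RingHom.mem_ker, map_sub, aeval_monomial_pow, aeval_monomial_pow,
    sum_expo, sum_expo, sub_eq_zero]
  exact Polynomial.monomial_left_inj one_ne_zero

theorem coeff_X_mul_eq_zero_of_isIsolated {a b c d : ℕ} (h : IsIsolated n r a b c d) (x : Fin 4)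
    {p : MvPolynomial (Fin 4) k} (hp : p ∈ monomialCurveIdeal k (backelinSeq n r)) :
    coeff (expo a b c d) (X x * p) = 0 := by
  rw [coeff_X_mul']
  split_ifs with hx
  · refine coeff_eq_zero_of_mem_monomialCurveIdeal hp fun v hv => ?_
    have hle : Finsupp.single x 1 ≤ expo a b c d := by
      rw [Finsupp.single_le_iff]
      exact Nat.one_le_iff_ne_zero.2 (Finsupp.mem_support_iff.1 hx)
    suffices v + Finsupp.single x 1 = expo a b c d from eq_tsub_of_add_eq this
    have hw : ∑ i, (v + Finsupp.single x 1 : Fin 4 →₀ ℕ) i * backelinSeq n r i = weight n r a b c d := by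
      rw [← sum_expo, ← tsub_add_cancel_of_le hle]
      simp only [Finsupp.add_apply, add_mul, Finset.sum_add_distrib, hv]
    have hv0 : 0 < (v + Finsupp.single x 1 : Fin 4 →₀ ℕ) x := by simp
    have hx0 : 0 < expo a b c d x := Nat.pos_of_ne_zero (Finsupp.mem_support_iff.1 hx)
    generalize v + Finsupp.single x 1 = w at hw hv0
    rw [eq_expo w] at hw hv0 ⊢
    rw [sum_expo] at hw
    rw [expo_inj]
    refine h _ _ _ _ hw ?_
    fin_cases x
    · exact Or.inl ⟨hx0, hv0⟩
    · exact Or.inr (Or.inl ⟨hx0, hv0⟩)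
    · exact Or.inr (Or.inr (Or.inl ⟨hx0, hv0⟩))
    · exact Or.inr (Or.inr (Or.inr ⟨hx0, hv0⟩))
  · rfl

end Backelin

namespace Backelin

open MvPolynomial

variable {k : Type*} [Field k] {n r : ℕ}

/-- The binomial `x₁ᵃ x₂ᵇ x₃ᶜ x₄ᵈ - x₁ᵃ' x₂ᵇ' x₃ᶜ' x₄ᵈ'` lies in the ideal spanned by `gens`. -/
def Rel (k : Type*) [Field k] (n r a b c d a' b' c' d' : ℕ) : Prop :=
  monomial (expo a b c d) (1 : k) - monomial (expo a' b' c' d') 1 ∈ Ideal.span (gens k n r)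

theorem Rel.refl (a b c d : ℕ) : Rel k n r a b c d a b c d := by
  rw [Rel, sub_self]
  exact zero_mem _

theorem Rel.symm {a b c d a' b' c' d' : ℕ} (h : Rel k n r a b c d a' b' c' d') :
    Rel k n r a' b' c' d' a b c d := by
  rw [Rel, ← neg_sub]
  exact neg_mem h

theorem Rel.trans {a b c d a' b' c' d' a'' b'' c'' d'' : ℕ}
    (h : Rel k n r a b c d a' b' c' d') (h' : Rel k n r a' b' c' d' a'' b'' c'' d'') :
    Rel k n r a b c d a'' b'' c'' d'' := by
  have := add_mem h h'
  rwa [sub_add_sub_cancel] at this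

theorem expo_add (a b c d a' b' c' d' : ℕ) :
    expo a b c d + expo a' b' c' d' = expo (a + a') (b + b') (c + c') (d + d') := by
  ext i
  fin_cases i <;> rfl

theorem Rel.add {a b c d a' b' c' d' : ℕ} (h : Rel k n r a b c d a' b' c' d')
    (A B C D : ℕ) :
    Rel k n r (a + A) (b + B) (c + C) (d + D) (a' + A) (b' + B) (c' + C) (d' + D) := by
  have := Ideal.mul_mem_right (monomial (expo A B C D) (1 : k)) _ h
  rwa [sub_mul, monomial_mul, monomial_mul, one_mul, expo_add, expo_add] at this

/-- Rewriting a multiple of a monomial. -/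
theorem Rel.replace {a b c d a' b' c' d' A B C D : ℕ} (h : Rel k n r a b c d a' b' c' d')
    (ha : a ≤ A) (hb : b ≤ B) (hc : c ≤ C) (hd : d ≤ D) :
    Rel k n r A B C D (a' + (A - a)) (b' + (B - b)) (c' + (C - c)) (d' + (D - d)) := by
  have := h.add (A - a) (B - b) (C - c) (D - d)
  rwa [Nat.add_sub_cancel' ha, Nat.add_sub_cancel' hb, Nat.add_sub_cancel' hc,
    Nat.add_sub_cancel' hd] at this

theorem f₁_eq : f₁ k = monomial (expo 0 1 3 0) 1 - monomial (expo 1 0 0 3) 1 := by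
  simp [monomial_expo, f₁]

theorem f₂_eq (n i : ℕ) : f₂ k n i =
    monomial (expo (n - i) 0 (3 * i - 1) 0) 1 -
      monomial (expo 0 (n - i + 1) 0 (3 * i - 2)) 1 := by
  simp [monomial_expo, f₂]

theorem f₃_eq (n r j : ℕ) : f₃ k n r j =
    monomial (expo (r - n + 3 + j) (n - 1 - j) 0 0) 1 -
      monomial (expo 0 0 (2 + 3 * j) (r - 1 - 3 * j)) 1 := by
  simp [monomial_expo, f₃]

theorem f₄_eq (n r j : ℕ) : f₄ k n r j =
    monomial (expo (r - 2 * n + 3 + j) (2 * n - j) 0 0) 1 -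
      monomial (expo 0 0 (3 * j + 1) (r + 1 - 3 * j)) 1 := by
  simp [monomial_expo, f₄]

theorem f₅_eq (n r : ℕ) : f₅ k n r =
    monomial (expo (r - n + 2) n 1 0) 1 - monomial (expo 0 0 0 (r + 2)) 1 := by
  simp [monomial_expo, f₅]

theorem f₆_eq (n : ℕ) : f₆ k n =
    monomial (expo 0 (n + 1) 1 0) 1 - monomial (expo n 0 0 2) 1 := by
  simp [monomial_expo, f₆]

theorem f₇_eq (n : ℕ) : f₇ k n =
    monomial (expo 0 (2 * n + 1) 0 0) 1 - monomial (expo (2 * n - 1) 0 1 1) 1 := by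
  simp [monomial_expo, f₇]

theorem rel_f₁ : Rel k n r 0 1 3 0 1 0 0 3 := by
  rw [Rel, ← f₁_eq]
  exact Ideal.subset_span (by simp [gens])

theorem rel_f₂ {i : ℕ} (hi : 1 ≤ i) (hi' : i ≤ n) :
    Rel k n r (n - i) 0 (3 * i - 1) 0 0 (n - i + 1) 0 (3 * i - 2) := by
  rw [Rel, ← f₂_eq]
  exact Ideal.subset_span (Or.inl (Or.inl (Or.inl (Or.inr ⟨i, hi, hi', rfl⟩))))

theorem rel_f₃ {j : ℕ} (hj : j < n) :
    Rel k n r (r - n + 3 + j) (n - 1 - j) 0 0 0 0 (2 + 3 * j) (r - 1 - 3 * j) := by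
  rw [Rel, ← f₃_eq]
  exact Ideal.subset_span (Or.inl (Or.inl (Or.inr ⟨j, hj, rfl⟩)))

theorem rel_f₄ {j : ℕ} (hj : j < n) :
    Rel k n r (r - 2 * n + 3 + j) (2 * n - j) 0 0 0 0 (3 * j + 1) (r + 1 - 3 * j) := by
  rw [Rel, ← f₄_eq]
  exact Ideal.subset_span (Or.inl (Or.inr ⟨j, hj, rfl⟩))

theorem rel_f₅ : Rel k n r (r - n + 2) n 1 0 0 0 0 (r + 2) := by
  rw [Rel, ← f₅_eq]
  exact Ideal.subset_span (by simp [gens])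

theorem rel_f₆ : Rel k n r 0 (n + 1) 1 0 n 0 0 2 := by
  rw [Rel, ← f₆_eq]
  exact Ideal.subset_span (by simp [gens])

theorem rel_f₇ : Rel k n r 0 (2 * n + 1) 0 0 (2 * n - 1) 0 1 1 := by
  rw [Rel, ← f₇_eq]
  exact Ideal.subset_span (by simp [gens])

theorem rel_x₂_mul_x₄_pow (hn : 2 ≤ n) (hr : 3 * n + 2 ≤ r) :
    Rel k n r 0 1 0 r (r + 2) 0 0 0 := by
  have h1 := (rel_f₂ (k := k) (r := r) (show 1 ≤ n by omega) le_rfl).add 0 0 0 (r + 2 - 3 * n)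
  have h2 := rel_f₃ (k := k) (r := r) (show n - 1 < n by omega)
  convert h1.symm.trans (b'' := 0) (c'' := 0) (d'' := 0) (a'' := r + 2) ?_ using 1
  · omega
  · omega
  · convert h2.symm using 1 <;> omega

/-! The weights of the two terms of each binomial agree. -/

theorem weight_f₁ : weight n r 0 1 3 0 = weight n r 1 0 0 3 := by
  unfold weight
  ring

theorem weight_f₂ {i : ℕ} (hi : 1 ≤ i) (hi' : i ≤ n) :
    weight n r (n - i) 0 (3 * i - 1) 0 = weight n r 0 (n - i + 1) 0 (3 * i - 2) := by
  obtain ⟨i, rfl⟩ := Nat.exists_eq_add_of_le hi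
  obtain ⟨m, rfl⟩ := Nat.exists_eq_add_of_le hi'
  rw [show 1 + i + m - (1 + i) = m by omega, show 3 * (1 + i) - 1 = 3 * i + 2 by omega,
    show 3 * (1 + i) - 2 = 3 * i + 1 by omega]
  unfold weight
  ring

theorem weight_f₃ (hr : 3 * n + 2 ≤ r) {j : ℕ} (hj : j < n) :
    weight n r (r - n + 3 + j) (n - 1 - j) 0 0 =
      weight n r 0 0 (2 + 3 * j) (r - 1 - 3 * j) := by
  obtain ⟨m, rfl⟩ := Nat.exists_eq_add_of_lt hj
  obtain ⟨q, rfl⟩ := Nat.exists_eq_add_of_le hr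
  rw [show j + m + 1 - 1 - j = m by omega,
    show 3 * (j + m + 1) + 2 + q - (j + m + 1) + 3 + j = 3 * j + 2 * m + q + 7 by omega,
    show 3 * (j + m + 1) + 2 + q - 1 - 3 * j = 3 * m + 4 + q by omega]
  unfold weight
  ring

theorem weight_f₄ (hr : 3 * n + 2 ≤ r) {j : ℕ} (hj : j < n) :
    weight n r (r - 2 * n + 3 + j) (2 * n - j) 0 0 =
      weight n r 0 0 (3 * j + 1) (r + 1 - 3 * j) := by
  obtain ⟨m, rfl⟩ := Nat.exists_eq_add_of_lt hj
  obtain ⟨q, rfl⟩ := Nat.exists_eq_add_of_le hr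
  rw [show 2 * (j + m + 1) - j = j + 2 * m + 2 by omega,
    show 3 * (j + m + 1) + 2 + q - 2 * (j + m + 1) + 3 + j = 2 * j + m + q + 6 by omega,
    show 3 * (j + m + 1) + 2 + q + 1 - 3 * j = 3 * m + 6 + q by omega]
  unfold weight
  ring

theorem weight_f₅ (hr : 3 * n + 2 ≤ r) :
    weight n r (r - n + 2) n 1 0 = weight n r 0 0 0 (r + 2) := by
  obtain ⟨q, rfl⟩ := Nat.exists_eq_add_of_le hr
  rw [show 3 * n + 2 + q - n + 2 = 2 * n + 4 + q by omega]
  unfold weight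
  ring

theorem weight_f₆ : weight n r 0 (n + 1) 1 0 = weight n r n 0 0 2 := by
  unfold weight
  ring

theorem weight_f₇ (hn : 2 ≤ n) :
    weight n r 0 (2 * n + 1) 0 0 = weight n r (2 * n - 1) 0 1 1 := by
  obtain ⟨m, rfl⟩ := Nat.exists_eq_add_of_le hn
  rw [show 2 * (2 + m) - 1 = 2 * m + 3 by omega]
  unfold weight
  ring

theorem gens_subset (hn : 2 ≤ n) (hr : 3 * n + 2 ≤ r) :
    gens k n r ⊆ monomialCurveIdeal k (backelinSeq n r) := by
  rintro p ((((rfl | ⟨i, hi, hi', rfl⟩) | ⟨j, hj, rfl⟩) | ⟨j, hj, rfl⟩) | rfl | rfl | rfl) <;>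
    rw [SetLike.mem_coe]
  · rw [f₁_eq, monomial_sub_mem_iff, weight_f₁]
  · rw [f₂_eq, monomial_sub_mem_iff, weight_f₂ hi hi']
  · rw [f₃_eq, monomial_sub_mem_iff, weight_f₃ hr hj]
  · rw [f₄_eq, monomial_sub_mem_iff, weight_f₄ hr hj]
  · rw [f₅_eq, monomial_sub_mem_iff, weight_f₅ hr]
  · rw [f₆_eq, monomial_sub_mem_iff, weight_f₆]
  · rw [f₇_eq, monomial_sub_mem_iff, weight_f₇ hn]

theorem Rel.weight_eq (hn : 2 ≤ n) (hr : 3 * n + 2 ≤ r) {a b c d a' b' c' d' : ℕ}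
    (h : Rel k n r a b c d a' b' c' d') : weight n r a b c d = weight n r a' b' c' d' :=
  monomial_sub_mem_iff.1 (Ideal.span_le.2 (gens_subset hn hr) h)

/-- A monomial in `x₂, x₃, x₄` that is not normal is congruent to a multiple of `x₁`, unless it is
divisible by `x₃^(3n - 1)`. -/
theorem exists_rel_of_not_isNormal (k : Type*) [Field k] (hn : 2 ≤ n) (hr : 3 * n + 2 ≤ r)
    {b c d : ℕ} (hc : c + 2 ≤ 3 * n) (hN : ¬ IsNormal n r b c d) :
    ∃ A B C D, 0 < A ∧ Rel k n r 0 b c d A B C D := by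
  by_cases hbc : 1 ≤ b ∧ 3 ≤ c
  · exact ⟨_, _, _, _, by omega, rel_f₁.replace le_rfl hbc.1 hbc.2 (Nat.zero_le _)⟩
  have red₃ : ∀ j, j < n → 2 + 3 * j ≤ c → r - 1 - 3 * j ≤ d →
      ∃ A B C D, 0 < A ∧ Rel k n r 0 b c d A B C D := fun j hj h1 h2 =>
    ⟨_, _, _, _, by omega, (rel_f₃ hj).symm.replace le_rfl (Nat.zero_le _) h1 h2⟩
  unfold IsNormal at hN
  obtain rfl | rfl | hb | hb : b = 0 ∨ b = 1 ∨ (2 ≤ b ∧ b ≤ n) ∨ n + 1 ≤ b := by omega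
  · obtain h0 | h1 | h2 | h3 : c = 0 ∨ c % 3 = 1 ∨ c % 3 = 2 ∨ (3 ≤ c ∧ c % 3 = 0) := by omega
    · have hd : r + 2 ≤ d := by omega
      exact ⟨_, _, _, _, by omega,
        rel_f₅.symm.replace le_rfl le_rfl (Nat.zero_le _) hd⟩
    · have hj : c / 3 < n := by omega
      have hc : 3 * (c / 3) + 1 ≤ c := by omega
      have hd : r + 1 - 3 * (c / 3) ≤ d := by omega
      exact ⟨_, _, _, _, by omega, (rel_f₄ hj).symm.replace le_rfl le_rfl hc hd⟩
    · exact red₃ (c / 3) (by omega) (by omega) (by omega)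
    · exact red₃ (c / 3 - 1) (by omega) (by omega) (by omega)
  · by_cases hd : r ≤ d
    · exact ⟨_, _, _, _, by omega,
        (rel_x₂_mul_x₄_pow hn hr).replace le_rfl le_rfl (Nat.zero_le _) hd⟩
    · exact red₃ 0 (by omega) (by omega) (by omega)
  · have hi : 1 ≤ n + 1 - b := by omega
    have hi' : n + 1 - b ≤ n := by omega
    have hb' : n - (n + 1 - b) + 1 ≤ b := by omega
    have hd : 3 * (n + 1 - b) - 2 ≤ d := by omega
    exact ⟨_, _, _, _, by omega, (rel_f₂ hi hi').symm.replace le_rfl hb' (Nat.zero_le _) hd⟩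
  · obtain h1 | h1 | h1 : 1 ≤ c ∨ 1 ≤ d ∨ 2 * n + 1 ≤ b := by omega
    · exact ⟨_, _, _, _, by omega, rel_f₆.replace le_rfl hb h1 (Nat.zero_le _)⟩
    · have hb' : n - 1 + 1 ≤ b := by omega
      have hd : 3 * 1 - 2 ≤ d := by omega
      exact ⟨_, _, _, _, by omega,
        (rel_f₂ le_rfl (show 1 ≤ n by omega)).symm.replace le_rfl hb' (Nat.zero_le _) hd⟩
    · exact ⟨_, _, _, _, by omega,
        rel_f₇.replace le_rfl h1 (Nat.zero_le _) (Nat.zero_le _)⟩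

/-- Every monomial is congruent to a power of `x₁` times a normal monomial. -/
theorem exists_rel_isNormal (k : Type*) [Field k] (hn : 2 ≤ n) (hr : 3 * n + 2 ≤ r)
    (a b c d : ℕ) : ∃ a' b' c' d', IsNormal n r b' c' d' ∧ Rel k n r a b c d a' b' c' d' := by
  obtain ⟨w, hw⟩ : ∃ w, w = weight n r a b c d := ⟨_, rfl⟩
  induction w using Nat.strong_induction_on generalizing a b c d with
  | _ w ihw =>
  subst hw
  induction c using Nat.strong_induction_on generalizing a b d with
  | _ c ihc =>
  have lower : ∀ {A B C D : ℕ}, Rel k n r a b c d A B C D → 0 < A →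
      ∃ a' b' c' d', IsNormal n r b' c' d' ∧ Rel k n r a b c d a' b' c' d' := by
    intro A B C D h hA
    obtain ⟨A, rfl⟩ := Nat.exists_eq_add_of_lt hA
    have hlt : weight n r A B C D < weight n r a b c d := by
      rw [h.weight_eq hn hr]
      unfold weight
      have : 0 < r * (3 * n + 2) + 3 := by positivity
      linarith
    obtain ⟨a', b', c', d', h1, h2⟩ := ihw _ hlt A B C D rfl
    have h3 := h2.add 1 0 0 0
    rw [show A + 1 = 0 + A + 1 by omega] at h3
    exact ⟨a' + 1, b', c', d', h1, h.trans h3⟩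
  rcases Nat.eq_zero_or_pos a with rfl | ha
  swap
  · exact lower (Rel.refl a b c d) ha
  by_cases hc : 3 * n ≤ c + 1
  · have h : Rel k n r 0 0 (3 * n - 1) 0 0 1 0 (3 * n - 2) := by
      have := rel_f₂ (k := k) (r := r) (show 1 ≤ n by omega) le_rfl
      rwa [Nat.sub_self] at this
    have h1 : Rel k n r 0 b c d _ _ _ _ :=
      h.replace le_rfl (Nat.zero_le b) (show 3 * n - 1 ≤ c by omega) (Nat.zero_le d)
    obtain ⟨a', b', c', d', h2, h3⟩ := ihc (0 + (c - (3 * n - 1))) (by omega) (0 + (0 - 0))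
      (1 + (b - 0)) (3 * n - 2 + (d - 0))
      (fun w' hw' => ihw w' (by rwa [h1.weight_eq hn hr]))
    exact ⟨a', b', c', d', h2, h1.trans h3⟩
  by_cases hN : IsNormal n r b c d
  · exact ⟨0, b, c, d, hN, Rel.refl _ _ _ _⟩
  obtain ⟨A, B, C, D, hA, h⟩ := exists_rel_of_not_isNormal k hn hr (by omega) hN
  exact lower h hA

theorem span_gens (k : Type*) [Field k] (hn : 2 ≤ n) (hr : 3 * n + 2 ≤ r) :
    Ideal.span (gens k n r) = monomialCurveIdeal k (backelinSeq n r) := by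
  refine le_antisymm (Ideal.span_le.2 (gens_subset hn hr)) (monomialCurveIdeal_le fun u v h => ?_)
  rw [eq_expo u, eq_expo v] at h ⊢
  rw [sum_expo, sum_expo] at h
  obtain ⟨a, b, c, d, hN, h1⟩ := exists_rel_isNormal k hn hr (u 0) (u 1) (u 2) (u 3)
  obtain ⟨a', b', c', d', hN', h1'⟩ := exists_rel_isNormal k hn hr (v 0) (v 1) (v 2) (v 3)
  obtain ⟨rfl, rfl, rfl, rfl⟩ := hN.eq_of_weight_eq hn hr hN'
    (by rw [← h1.weight_eq hn hr, h, h1'.weight_eq hn hr])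
  exact h1.trans h1'.symm

/-- The indices of the binomials `f₂`, `f₃`, `f₄`, and of `f₁`, `f₅`, `f₆`, `f₇`. -/
abbrev Index (n : ℕ) : Type := Fin n ⊕ Fin n ⊕ Fin n ⊕ Fin 4

/-- The family of all the binomials. -/
noncomputable def gen (k : Type*) [Field k] (n r : ℕ) : Index n → MvPolynomial (Fin 4) k
  | .inl i => f₂ k n (i + 1)
  | .inr (.inl j) => f₃ k n r j
  | .inr (.inr (.inl j)) => f₄ k n r j
  | .inr (.inr (.inr 0)) => f₁ k
  | .inr (.inr (.inr 1)) => f₅ k n r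
  | .inr (.inr (.inr 2)) => f₆ k n
  | .inr (.inr (.inr 3)) => f₇ k n

/-- The exponents `(a, b, c)` of the first terms `x₁ᵃ x₂ᵇ x₃ᶜ` of the binomials. -/
def lead (n r : ℕ) : Index n → ℕ × ℕ × ℕ
  | .inl i => (n - (i + 1), 0, 3 * (i + 1) - 1)
  | .inr (.inl j) => (r - n + 3 + j, n - 1 - j, 0)
  | .inr (.inr (.inl j)) => (r - 2 * n + 3 + j, 2 * n - j, 0)
  | .inr (.inr (.inr 0)) => (0, 1, 3)
  | .inr (.inr (.inr 1)) => (r - n + 2, n, 1)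
  | .inr (.inr (.inr 2)) => (0, n + 1, 1)
  | .inr (.inr (.inr 3)) => (0, 2 * n + 1, 0)

theorem range_gen (k : Type*) [Field k] (n r : ℕ) : Set.range (gen k n r) = gens k n r := by
  ext p
  constructor
  · rintro ⟨i | j | j | j, rfl⟩
    · exact Or.inl (Or.inl (Or.inl (Or.inr ⟨i + 1, by omega, by omega, rfl⟩)))
    · exact Or.inl (Or.inl (Or.inr ⟨j, j.2, rfl⟩))
    · exact Or.inl (Or.inr ⟨j, j.2, rfl⟩)
    · fin_cases j <;> simp [gen, gens]
  · rintro ((((rfl | ⟨i, hi, hi', rfl⟩) | ⟨j, hj, rfl⟩) | ⟨j, hj, rfl⟩) | rfl | rfl | rfl)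
    · exact ⟨.inr (.inr (.inr 0)), rfl⟩
    · refine ⟨.inl ⟨i - 1, by omega⟩, ?_⟩
      simp only [gen, Nat.sub_add_cancel hi]
    · exact ⟨.inr (.inl ⟨j, hj⟩), rfl⟩
    · exact ⟨.inr (.inr (.inl ⟨j, hj⟩)), rfl⟩
    · exact ⟨.inr (.inr (.inr 1)), rfl⟩
    · exact ⟨.inr (.inr (.inr 2)), rfl⟩
    · exact ⟨.inr (.inr (.inr 3)), rfl⟩

theorem lead_injective (hn : 2 ≤ n) (hr : 3 * n + 2 ≤ r) : Function.Injective (lead n r) := by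
  rintro (i | i | i | i) (j | j | j | j) h
  all_goals first
    | (fin_cases i <;> fin_cases j <;> simp [lead] at h ⊢)
    | (fin_cases j <;> simp [lead] at h ⊢ <;> omega)
    | (fin_cases i <;> simp [lead] at h ⊢ <;> omega)
    | (simp [lead, Fin.ext_iff] at h ⊢; omega)

theorem gen_eq_sub (hr : 3 * n + 2 ≤ r) (j : Index n) : ∃ a b c d, 0 < d ∧
    gen k n r j = monomial (expo (lead n r j).1 (lead n r j).2.1 (lead n r j).2.2 0) 1 -
      monomial (expo a b c d) 1 := by
  rcases j with i | j | j | j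
  · exact ⟨_, _, _, _, by omega, f₂_eq n (i + 1)⟩
  · exact ⟨_, _, _, _, by omega, f₃_eq n r j⟩
  · exact ⟨_, _, _, _, by omega, f₄_eq n r j⟩
  · fin_cases j
    · exact ⟨_, _, _, _, by omega, f₁_eq⟩
    · exact ⟨_, _, _, _, by omega, f₅_eq n r⟩
    · exact ⟨_, _, _, _, by omega, f₆_eq n⟩
    · exact ⟨_, _, _, _, by omega, f₇_eq n⟩

theorem coeff_lead_gen (hn : 2 ≤ n) (hr : 3 * n + 2 ≤ r) (i j : Index n) :
    coeff (expo (lead n r i).1 (lead n r i).2.1 (lead n r i).2.2 0) (gen k n r j) =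
      if i = j then 1 else 0 := by
  obtain ⟨a, b, c, d, hd, h⟩ := gen_eq_sub (k := k) hr j
  rw [h, coeff_sub, coeff_monomial, coeff_monomial, if_neg (c := expo a b c d = _), sub_zero]
  · refine if_congr ?_ rfl rfl
    rw [expo_inj]
    constructor
    · rintro ⟨h1, h2, h3, -⟩
      exact (lead_injective hn hr (Prod.ext h1 (Prod.ext h2 h3))).symm
    · rintro rfl
      simp
  · rw [expo_inj]
    omega

theorem isIsolated_lead (hn : 2 ≤ n) (hr : 3 * n + 2 ≤ r) (i : Index n) :
    IsIsolated n r (lead n r i).1 (lead n r i).2.1 (lead n r i).2.2 0 := by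
  rcases i with i | j | j | j
  · exact isIsolated_f₂ hn hr (by omega) (by omega)
  · exact isIsolated_f₃ hn hr j.2
  · exact isIsolated_f₄ hn hr j.2
  · fin_cases j
    · exact isIsolated_f₁ hn hr
    · exact isIsolated_f₅ hn hr
    · exact isIsolated_f₆ hn hr
    · exact isIsolated_f₇ hn hr

theorem encard_gens (k : Type*) [Field k] (hn : 2 ≤ n) (hr : 3 * n + 2 ≤ r) :
    (gens k n r).encard = Fintype.card (Index n) := by
  have hinj : Function.Injective (gen k n r) := by
    intro i j h
    have h1 := coeff_lead_gen (k := k) hn hr i i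
    rw [h, coeff_lead_gen hn hr, if_pos rfl] at h1
    by_contra hij
    rw [if_neg hij] at h1
    exact zero_ne_one h1
  rw [← range_gen, ← Set.image_univ, hinj.encard_image, Set.encard_univ, ENat.card_eq_coe_fintype_card]

theorem card_index_le_encard (k : Type*) [Field k] (hn : 2 ≤ n) (hr : 3 * n + 2 ≤ r)
    {T : Set (MvPolynomial (Fin 4) k)}
    (hT : Ideal.span T = monomialCurveIdeal k (backelinSeq n r)) :
    (Fintype.card (Index n) : ℕ∞) ≤ T.encard := by
  refine card_le_encard_of_span_eq (g := gen k n r) (fun i => ?_)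
    (fun i j => coeff_lead_gen hn hr i j)
    (fun i x p hp => coeff_X_mul_eq_zero_of_isIsolated (isIsolated_lead hn hr i) x hp) hT
  exact gens_subset hn hr (range_gen k n r ▸ Set.mem_range_self i)

end Backelin

theorem mainTheorem4 (k : Type*) [Field k] (n r : ℕ) (hn : 2 ≤ n) (hr : 3 * n + 2 ≤ r) :
    -- the binomials generate the defining ideal
    Ideal.span (Backelin.gens k n r) = monomialCurveIdeal k (backelinSeq n r) ∧
    -- no proper subset of them does
    (∀ T : Set (MvPolynomial (Fin 4) k), T ⊂ Backelin.gens k n r →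
      Ideal.span T ≠ monomialCurveIdeal k (backelinSeq n r)) ∧
    -- the listed binomials are pairwise distinct, and no generating set has fewer elements
    (Backelin.gens k n r).encard = 3 * n + 4 ∧
    (∀ T : Set (MvPolynomial (Fin 4) k),
      Ideal.span T = monomialCurveIdeal k (backelinSeq n r) →
      (Backelin.gens k n r).encard ≤ T.encard) := by
  refine ⟨Backelin.span_gens k hn hr, fun T hT h => ?_, ?_, fun T hT => ?_⟩
  · have hfin : (Backelin.gens k n r).Finite := by
      rw [← Backelin.range_gen]
      exact Set.finite_range _
    have h1 := (hfin.subset hT.1).encard_lt_encard hT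
    rw [Backelin.encard_gens k hn hr] at h1
    exact absurd (Backelin.card_index_le_encard k hn hr h) (not_le.2 h1)
  · rw [Backelin.encard_gens k hn hr]
    simp only [Fintype.card_sum, Fintype.card_fin]
    norm_cast
    omega
  · rw [Backelin.encard_gens k hn hr]
    exact Backelin.card_index_le_encard k hn hr hT
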